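/- Let $\mathcal C$ be a class of groups, closed under isomorphism, under free products $A*B$ and under subgroups of finite index, and containing the infinite cyclic group $\mathbb Z$. Let $\sigma:\mathcal C\to\mathbb R$ be a mapping that takes equal values on isomorphic groups, such that $\sigma(\mathbb Z)=0$ and such that for every $G\in\mathcal C$ the net $\left(\frac{\sigma(H)}{[G:H]}\right)_{H}$, indexed by the subgroups $H$ of finite index of $G$ (directed by reverse inclusion), is bounded. For $G\in\mathcal C$ let $$V_\sigma(G)=\limsup_{H}\frac{\sigma(H)}{[G:H]}=\inf_{H}\ \sup_{K\le H}\frac{\sigma(K)}{[G:K]},$$ where $H$ and $K$ run over subgroups of finite index of $G$. Define the extended volume by $\widetilde V_\sigma(G)=-\frac1{|G|}$ if $G$ is finite (in $\mathcal C$ or not) and $\widetilde V_\sigma(G)=V_\sigma(G)$ if $G\in\mathcal C$ is infinite; and if $G$ is infinite and not in $\mathcal C$, but has a subgroup $K$ of finite index with $K\in\mathcal C$, put $\widetilde V_\sigma(G)=\frac{V_\sigma(K)}{[G:K]}$ (this does not depend on $K$). Let $A$ and $B$ range over the groups that are in $\mathcal C$ or finite. Then $A*B$ is finite or has a subgroup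 of finite index in $\mathcal C$, so that $\widetilde V_\sigma(A*B)$ is defined, and: (i) If $\sigma(A'*B')\ge\sigma(A')+\sigma(B')+1$ for all $A',B'\in\mathcal C$, then $\widetilde V_\sigma(A*B)\ge\widetilde V_\sigma(A)+\widetilde V_\sigma(B)+1$ for all such $A,B$. (ii) If $\sigma(A'*B')\le\sigma(A')+\sigma(B')+1$ for all $A',B'\in\mathcal C$, then $\widetilde V_\sigma(A*B)\le\widetilde V_\sigma(A)+\widetilde V_\sigma(B)+1$ for all such $A,B$. -/

import Mathlib

open scoped Monoid.Coprod

universe u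

/-- A class of groups, given by its membership predicate. -/
abbrev GroupClass := ∀ (G : Type u) [Group G], Prop

/-- A real number attached to every group; only the values on the class under consideration are
ever used. -/
abbrev GroupInvariant := ∀ (G : Type u) [Group G], ℝ

/-- `C` is closed under isomorphism. -/
def GroupClass.IsoClosed (C : GroupClass.{u}) : Prop :=
  ∀ (G H : Type u) [Group G] [Group H], C G → Nonempty (G ≃* H) → C H

/-- `C` is closed under subgroups of finite index. -/
def GroupClass.FiniteIndexClosed (C : GroupClass.{u}) : Prop :=
  ∀ (G : Type u) [Group G] (H : Subgroup G), C G → H.FiniteIndex → C H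

/-- `C` is closed under (binary) free products. -/
def GroupClass.FreeProductClosed (C : GroupClass.{u}) : Prop :=
  ∀ (A B : Type u) [Group A] [Group B], C A → C B → C (A ∗ B)

/-- `G` has a subgroup of finite index that belongs to `C`. -/
def GroupClass.Virtually (C : GroupClass.{u}) (G : Type u) [Group G] : Prop :=
  ∃ K : Subgroup G, K.FiniteIndex ∧ C K

/-- The union of the class `C` and the class of finite groups. -/
def GroupClass.OrFinite (C : GroupClass.{u}) (G : Type u) [Group G] : Prop :=
  C G ∨ Finite G

/-- The infinite cyclic group, written multiplicatively, in an arbitrary universe. -/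
abbrev InfCyclic : Type u := ULift.{u} (Multiplicative ℤ)

/-- On `C`, the mapping `σ` takes equal values on isomorphic groups. -/
def GroupInvariant.IsoInvariantOn (σ : GroupInvariant.{u}) (C : GroupClass.{u}) : Prop :=
  ∀ (G H : Type u) [Group G] [Group H], C G → C H → Nonempty (G ≃* H) → σ G = σ H

/-- For every `G` in `C`, the net `σ(H) / [G : H]`, indexed by the subgroups `H` of finite index
of `G`, is bounded. -/
def GroupInvariant.BoundedNetsOn (σ : GroupInvariant.{u}) (C : GroupClass.{u}) : Prop :=
  ∀ (G : Type u) [Group G], C G →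
    ∃ M : ℝ, ∀ H : Subgroup G, H.FiniteIndex → |σ H / (H.index : ℝ)| ≤ M

/-- The `σ`-volume: the upper limit of `σ(H) / [G : H]` over the subgroups `H` of finite index of
`G`, directed by reverse inclusion, that is `inf_H sup_{K ≤ H} σ(K) / [G : K]`. -/
noncomputable def sigmaVolume (σ : GroupInvariant.{u}) (G : Type u) [Group G] : EReal :=
  ⨅ (H : Subgroup G) (_ : H.FiniteIndex),
    ⨆ (K : Subgroup G) (_ : K.FiniteIndex) (_ : K ≤ H), ((σ K / (K.index : ℝ) : ℝ) : EReal)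

open Classical in
/-- The extended volume: `-1 / |G|` if `G` is finite, and the `σ`-volume of `G` if `G` is infinite
and in `C`. An infinite group `G` outside `C` that has a subgroup `K` of finite index in `C` gets
the value `V_σ(K) / [G : K]` (Wall's extension of the `σ`-volume to the groups that are virtually
in `C`). All other groups get the irrelevant value `0`. -/
noncomputable def extVolume (C : GroupClass.{u}) (σ : GroupInvariant.{u})
    (G : Type u) [Group G] : EReal :=
  if Finite G then ((-1 / (Nat.card G : ℝ) : ℝ) : EReal)
  else if C G then sigmaVolume σ G
  else if h : C.Virtually G then sigmaVolume σ h.choose / ((h.choose.index : ℝ) : EReal)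
  else 0

/-! The heart is the Kurosh subgroup theorem with a count of factors. A subgroup `H` of index `n` in
`A ∗ B` is a free product of `p` groups that are stabilizers for `A` acting on the cosets of `H`, of
`q` such groups for `B`, and of a free group of rank `r`. Here `p` and `q` are the numbers of
orbits, the indices of the stabilizers sum to `n` on either side, and `p + q + r = n + 1`. The last
equation is an Euler characteristic: in the bipartite graph with the orbits as vertices and the `n`
cosets as edges, `r` edges lie outside a spanning tree.

Let `τ` be `σ`, except that `τ = -1` on trivial groups. Then the extended volume is simply the
volume of `τ`, and `τ + 1` vanishes on trivial groups. Hypothesis (ii) makes `τ + 1` subadditive for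
free products, and (i) does the same for `-(τ + 1)`. In case (ii), if the stabilizers satisfy `τ ≤ a
* index` and `τ ≤ b * index`, then `τ H + 1 ≤ (a + b) n + (p + q + r) = (a + b + 1) n + 1`, because
`τ + 1` is `1` on the infinite cyclic group. Division by `n` gives the bound `a + b + 1`; case (i)
is the same with signs reversed.

It remains to choose `H` with good stabilizers (`sigmaVolume_coprod_le`, `le_sigmaVolume_coprod`).
For the upper bound, every `H` that projects into small normal subgroups of the factors will do. For
the lower bound, `H` is built so that all stabilizers are conjugates of one prescribed subgroup of
each factor. -/

/-! ### Orbit sections and cocycles of group actions -/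

/-- A choice of a base point in every orbit, and for every point `x` of an element moving the base
point of its orbit to `x`. -/
structure OrbitSection (K X : Type*) [Group K] [MulAction K X] where
  rep : MulAction.orbitRel.Quotient K X → X
  mk_rep : ∀ ω, Quotient.mk'' (rep ω) = ω
  tr : X → K
  tr_smul : ∀ x, tr x • rep (Quotient.mk'' x) = x
  tr_rep : ∀ ω, tr (rep ω) = 1

namespace OrbitSection

section

variable {K X P : Type*} [Group K] [MulAction K X] [Group P]

/-- The base points can be chosen to minimize a given function on every orbit. -/
theorem exists_minimal (ℓ : X → ℕ) :
    ∃ s : OrbitSection K X, ∀ x, ℓ (s.rep (Quotient.mk'' x)) ≤ ℓ x := by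
  classical
  have h : ∀ ω : MulAction.orbitRel.Quotient K X, ∃ y : X,
      (Quotient.mk'' y : MulAction.orbitRel.Quotient K X) = ω ∧
        ∀ x, (Quotient.mk'' x : MulAction.orbitRel.Quotient K X) = ω → ℓ y ≤ ℓ x := by
    intro ω
    obtain ⟨y, hy, hmin⟩ := (measure ℓ).wf.has_min
      {x | (Quotient.mk'' x : MulAction.orbitRel.Quotient K X) = ω}
      (Quotient.inductionOn' ω fun x => ⟨x, rfl⟩)
    exact ⟨y, hy, fun x hx => not_lt.1 (hmin x hx)⟩
  choose r hr hmin using h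
  have ht : ∀ x : X, ∃ k : K, k • r (Quotient.mk'' x) = x ∧
      ((∃ ω, x = r ω) → k = 1) := by
    intro x
    by_cases hx : ∃ ω, x = r ω
    · obtain ⟨ω, rfl⟩ := hx
      exact ⟨1, by rw [hr, one_smul], fun _ => rfl⟩
    · have h1 := hr (Quotient.mk'' x)
      obtain ⟨k, hk⟩ := MulAction.orbitRel_apply.1 (Quotient.exact h1.symm)
      exact ⟨k, hk, fun h => absurd h hx⟩
  choose t ht1 ht2 using ht
  exact ⟨⟨r, hr, t, ht1, fun ω => ht2 _ ⟨ω, rfl⟩⟩, fun x => hmin _ x rfl⟩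

variable (s : OrbitSection K X)

theorem rep_injective : Function.Injective s.rep := fun a b h => by
  rw [← s.mk_rep a, ← s.mk_rep b, h]

theorem mk_smul (k : K) (x : X) :
    (Quotient.mk'' (k • x) : MulAction.orbitRel.Quotient K X) = Quotient.mk'' x :=
  Quotient.sound' ⟨k, rfl⟩

/-- Going from the base point to `x`, then by `k`, then back along the chosen path is a loop at the
base point. -/
theorem tr_conj_mem (k : K) (x : X) :
    (s.tr (k • x))⁻¹ * k * s.tr x ∈ MulAction.stabilizer K (s.rep (Quotient.mk'' x)) := by
  rw [MulAction.mem_stabilizer_iff, mul_smul, s.tr_smul, mul_smul, inv_smul_eq_iff]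
  conv_rhs => rw [← mk_smul k x, s.tr_smul]

variable (θ : ∀ ω, MulAction.stabilizer K (s.rep ω) →* P) (u : X → P)

theorem apply_congr {ω ω' : MulAction.orbitRel.Quotient K X} (h : ω = ω') {a a' : K}
    (ha : a = a') (hm : a ∈ MulAction.stabilizer K (s.rep ω))
    (hm' : a' ∈ MulAction.stabilizer K (s.rep ω')) : θ ω ⟨a, hm⟩ = θ ω' ⟨a', hm'⟩ := by
  subst h; subst ha; rfl

/-- The functor from the action groupoid to `P` that is given by homomorphisms on the
stabilizers of the base points and by the values `u` on the chosen paths. -/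
def cocycle (k : K) (x : X) : P :=
  u (k • x) * θ (Quotient.mk'' x) ⟨_, s.tr_conj_mem k x⟩ * (u x)⁻¹

theorem cocycle_one (x : X) : s.cocycle θ u 1 x = 1 := by
  have : θ (Quotient.mk'' x) ⟨_, s.tr_conj_mem 1 x⟩ = θ (Quotient.mk'' x) ⟨1, one_mem _⟩ :=
    s.apply_congr θ rfl (by simp) _ _
  rw [cocycle, this, one_smul]
  have h1 : θ (Quotient.mk'' x) ⟨1, one_mem _⟩ = 1 := map_one _
  simp [h1]

/-- The loops at the base point telescope, and so do the values of `u`. The orbits of `x` and `k •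
x` are only propositionally equal, hence the detour through `apply_congr`. -/
theorem cocycle_mul (k' k : K) (x : X) :
    s.cocycle θ u (k' * k) x = s.cocycle θ u k' (k • x) * s.cocycle θ u k x := by
  have h1 : θ (Quotient.mk'' (k • x)) ⟨_, s.tr_conj_mem k' (k • x)⟩ =
      θ (Quotient.mk'' x) ⟨(s.tr (k' • k • x))⁻¹ * k' * s.tr (k • x), by
        have := s.tr_conj_mem k' (k • x)
        rwa [mk_smul] at this⟩ := s.apply_congr θ (mk_smul _ _) rfl _ _
  have h2 : θ (Quotient.mk'' x) ⟨_, s.tr_conj_mem (k' * k) x⟩ =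
      θ (Quotient.mk'' (k • x)) ⟨_, s.tr_conj_mem k' (k • x)⟩ *
        θ (Quotient.mk'' x) ⟨_, s.tr_conj_mem k x⟩ := by
    rw [h1, ← map_mul]
    refine s.apply_congr θ rfl ?_ _ _
    change _ = (s.tr (k' • k • x))⁻¹ * k' * s.tr (k • x) * ((s.tr (k • x))⁻¹ * k * s.tr x)
    rw [mul_smul]; group
  rw [cocycle, cocycle, cocycle, h2, mul_smul]
  group

theorem cocycle_rep (ω : MulAction.orbitRel.Quotient K X)
    (k : MulAction.stabilizer K (s.rep ω)) :
    s.cocycle θ u k (s.rep ω) = u (s.rep ω) * θ ω k * (u (s.rep ω))⁻¹ := by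
  have hk : (k : K) • s.rep ω = s.rep ω := k.2
  have : θ (Quotient.mk'' (s.rep ω)) ⟨_, s.tr_conj_mem k (s.rep ω)⟩ = θ ω ⟨k, k.2⟩ :=
    s.apply_congr θ (s.mk_rep ω) (by rw [hk, s.tr_rep]; group) _ _
  rw [cocycle, this, hk]

theorem cocycle_tr (x : X) :
    s.cocycle θ u (s.tr x) (s.rep (Quotient.mk'' x)) =
      u x * (u (s.rep (Quotient.mk'' x)))⁻¹ := by
  have : θ (Quotient.mk'' (s.rep (Quotient.mk'' x)))
      ⟨_, s.tr_conj_mem (s.tr x) (s.rep (Quotient.mk'' x))⟩ =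
      θ (Quotient.mk'' x) ⟨1, one_mem _⟩ :=
    s.apply_congr θ (s.mk_rep _) (by rw [s.tr_smul, s.tr_rep]; group) _ _
  rw [cocycle, this, s.tr_smul]
  have h1 : θ (Quotient.mk'' x) ⟨1, one_mem _⟩ = 1 := map_one _
  simp [h1]

/-- The action of `K` on the trivial `P`-bundle over `X` given by a cocycle. -/
def bundleHom : K →* Function.End (P × X) where
  toFun k := fun z => (s.cocycle θ u k z.2 * z.1, k • z.2)
  map_one' := by
    funext z
    change (_, _) = z
    simp [cocycle_one]
  map_mul' k k' := by
    funext z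
    change (_, _) = (_, _)
    simp [cocycle_mul, mul_smul, mul_assoc]

end

end OrbitSection

/-! ### The Kurosh subgroup theorem -/

namespace Monoid.Coprod

variable {A B X : Type*} [Group A] [Group B] [MulAction A X] [MulAction B X]

/-- Every point has a word length with respect to the two factors. -/
theorem exists_length [MulAction (A ∗ B) X] [MulAction.IsPretransitive (A ∗ B) X]
    (hA : ∀ (a : A) (x : X), (inl a : A ∗ B) • x = a • x)
    (hB : ∀ (b : B) (x : X), (inr b : A ∗ B) • x = b • x) (x₀ : X) :
    ∃ ℓ : X → ℕ, ∀ x, x ≠ x₀ → (∃ a : A, ℓ (a • x) < ℓ x) ∨ ∃ b : B, ℓ (b • x) < ℓ x := by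
  classical
  have hex : ∀ x : X, ∃ n, ∃ w : List (A ⊕ B), w.length = n ∧
      (mk (FreeMonoid.ofList w) : A ∗ B) • x₀ = x := by
    intro x
    obtain ⟨g, rfl⟩ := MulAction.exists_smul_eq (A ∗ B) x₀ x
    obtain ⟨w, rfl⟩ := mk_surjective g
    exact ⟨_, FreeMonoid.toList w, rfl, rfl⟩
  -- The length is that of a shortest word carrying `x₀` to `x`; undoing its first letter shortens
  -- it.
  refine ⟨fun x => Nat.find (hex x), fun x hx => ?_⟩
  obtain ⟨w, hw, hwx⟩ := Nat.find_spec (hex x)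
  rcases w with _ | ⟨c, w⟩
  · exact absurd (by simpa using hwx.symm) hx
  · have hlt : w.length < Nat.find (hex x) := by rw [← hw]; simp
    have hm : (mk (FreeMonoid.of c) : A ∗ B) • (mk (FreeMonoid.ofList w) : A ∗ B) • x₀ = x := by
      rw [smul_smul, ← map_mul]; exact hwx
    rcases c with a | b
    · left
      refine ⟨a⁻¹, lt_of_le_of_lt (Nat.find_min' _ ⟨w, rfl, ?_⟩) hlt⟩
      rw [← hm, mk_of_inl, hA, inv_smul_smul]
    · right
      refine ⟨b⁻¹, lt_of_le_of_lt (Nat.find_min' _ ⟨w, rfl, ?_⟩) hlt⟩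
      rw [← hm, mk_of_inr, hB, inv_smul_smul]

section Kurosh

variable (sA : OrbitSection A X) (sB : OrbitSection B X)

/-- The points that are not a base point of their orbit under either factor. -/
def extraEdges : Set X := {x | x ∉ Set.range sA.rep ∧ x ∉ Set.range sB.rep}

/-- The free product of the stabilizers of all base points and of a free group. -/
abbrev KuroshProduct : Type _ :=
  (CoprodI (fun ω => MulAction.stabilizer A (sA.rep ω)) ∗
    CoprodI (fun ω => MulAction.stabilizer B (sB.rep ω))) ∗ FreeGroup (extraEdges sA sB)

/-- The embeddings of the stabilizers of the first factor into the Kurosh product. -/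
abbrev kuroshLeft (ω : MulAction.orbitRel.Quotient A X) :
    MulAction.stabilizer A (sA.rep ω) →* KuroshProduct sA sB :=
  inl.comp (inl.comp (CoprodI.of (M := fun ω => MulAction.stabilizer A (sA.rep ω)) (i := ω)))

/-- The embeddings of the stabilizers of the second factor into the Kurosh product. -/
abbrev kuroshRight (ω : MulAction.orbitRel.Quotient B X) :
    MulAction.stabilizer B (sB.rep ω) →* KuroshProduct sA sB :=
  inl.comp (inr.comp (CoprodI.of (M := fun ω => MulAction.stabilizer B (sB.rep ω)) (i := ω)))

open Classical in
/-- The value of the Kurosh cocycle on the chosen paths of the second factor. -/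
noncomputable def edgeValue (x : X) : KuroshProduct sA sB :=
  if h : x ∈ extraEdges sA sB then inr (FreeGroup.of ⟨x, h⟩) else 1

/-- The action of `A ∗ B` on the trivial bundle with fibre the Kurosh product. -/
noncomputable def kuroshBundle : A ∗ B →* Function.End (KuroshProduct sA sB × X) :=
  lift (sA.bundleHom (kuroshLeft sA sB) 1) (sB.bundleHom (kuroshRight sA sB) (edgeValue sA sB))

/-- The Kurosh cocycle. -/
noncomputable def kuroshCocycle (g : A ∗ B) (x : X) : KuroshProduct sA sB :=
  (kuroshBundle sA sB g (1, x)).1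

theorem kuroshCocycle_inl (a : A) (x : X) : kuroshCocycle sA sB (inl a) x =
    sA.cocycle (kuroshLeft sA sB) 1 a x := mul_one _

theorem kuroshCocycle_inr (b : B) (x : X) : kuroshCocycle sA sB (inr b) x =
    sB.cocycle (kuroshRight sA sB) (edgeValue sA sB) b x := mul_one _

theorem kuroshBundle_mul (g h : A ∗ B) (z : KuroshProduct sA sB × X) :
    kuroshBundle sA sB (g * h) z = kuroshBundle sA sB g (kuroshBundle sA sB h z) := by
  rw [map_mul]; rfl

/-- The universal property of `A ∗ B` extends actions, not cocycles. The cocycle is recovered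
because the factors, and hence all elements, act on the fibres by left multiplications. -/
theorem kuroshBundle_apply [MulAction (A ∗ B) X]
    (hA : ∀ (a : A) (x : X), (inl a : A ∗ B) • x = a • x)
    (hB : ∀ (b : B) (x : X), (inr b : A ∗ B) • x = b • x)
    (g : A ∗ B) (q : KuroshProduct sA sB) (x : X) :
    kuroshBundle sA sB g (q, x) = (kuroshCocycle sA sB g x * q, g • x) := by
  induction g using induction_on generalizing q x with
  | inl a =>
    rw [kuroshCocycle_inl, hA]; rfl
  | inr b =>
    rw [kuroshCocycle_inr, hB]; rfl
  | mul g h hg hh =>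
    rw [kuroshCocycle, kuroshBundle_mul, kuroshBundle_mul, hh, hg, hh, hg, mul_smul]
    simp [mul_assoc]

theorem kuroshCocycle_mul [MulAction (A ∗ B) X]
    (hA : ∀ (a : A) (x : X), (inl a : A ∗ B) • x = a • x)
    (hB : ∀ (b : B) (x : X), (inr b : A ∗ B) • x = b • x)
    (g h : A ∗ B) (x : X) : kuroshCocycle sA sB (g * h) x =
    kuroshCocycle sA sB g (h • x) * kuroshCocycle sA sB h x := by
  rw [kuroshCocycle, kuroshBundle_mul, kuroshBundle_apply sA sB hA hB,
    kuroshBundle_apply sA sB hA hB, mul_one]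

theorem kuroshCocycle_one (x : X) : kuroshCocycle sA sB 1 x = 1 := by
  rw [kuroshCocycle, map_one]; rfl

/-- A system of paths from `x₀` to all points of `X` along the chosen paths inside the orbits
of the two factors, which does not use the extra edges. -/
structure IsPathSystem (x₀ : X) (p : X → A ∗ B) : Prop where
  base : p x₀ = 1
  left : ∀ x, p x = inl (sA.tr x) * p (sA.rep (Quotient.mk'' x))
  right : ∀ x, x ∉ extraEdges sA sB → p x = inr (sB.tr x) * p (sB.rep (Quotient.mk'' x))

variable {sA sB}

/-- The homomorphism from the Kurosh product that is given by a system of paths. -/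
noncomputable def kuroshHom (p : X → A ∗ B) : KuroshProduct sA sB →* A ∗ B :=
  lift (lift
    (CoprodI.lift fun ω => (MulAut.conj (p (sA.rep ω))⁻¹).toMonoidHom.comp
      (inl.comp (Subgroup.subtype _)))
    (CoprodI.lift fun ω => (MulAut.conj (p (sB.rep ω))⁻¹).toMonoidHom.comp
      (inr.comp (Subgroup.subtype _))))
    (FreeGroup.lift fun x => (p x)⁻¹ * inr (sB.tr x) * p (sB.rep (Quotient.mk'' (x : X))))

theorem kuroshHom_left (p : X → A ∗ B) (ω) (a : MulAction.stabilizer A (sA.rep ω)) :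
    kuroshHom p (kuroshLeft sA sB ω a) = (p (sA.rep ω))⁻¹ * inl (a : A) * p (sA.rep ω) := by
  simp [kuroshHom]

theorem kuroshHom_right (p : X → A ∗ B) (ω) (b : MulAction.stabilizer B (sB.rep ω)) :
    kuroshHom p (kuroshRight sA sB ω b) = (p (sB.rep ω))⁻¹ * inr (b : B) * p (sB.rep ω) := by
  simp [kuroshHom]

theorem kuroshHom_edgeValue {x₀ : X} {p : X → A ∗ B} (h : IsPathSystem sA sB x₀ p) (x : X) :
    kuroshHom p (edgeValue sA sB x) =
      (p x)⁻¹ * inr (sB.tr x) * p (sB.rep (Quotient.mk'' x)) := by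
  by_cases hx : x ∈ extraEdges sA sB
  · simp [edgeValue, hx, kuroshHom]
  · rw [edgeValue, dif_neg hx, map_one, h.right x hx]
    group

/-- Both sides are cocycles in `g`, so it suffices to compare them on the two factors. For `g`
fixing `x₀` the right side is `g`, which makes `kuroshHom p` a left inverse of the cocycle on the
stabilizer. -/
theorem kuroshHom_cocycle [MulAction (A ∗ B) X] {x₀ : X} {p : X → A ∗ B} (h : IsPathSystem sA sB x₀ p)
    (hA : ∀ (a : A) (x : X), (inl a : A ∗ B) • x = a • x)
    (hB : ∀ (b : B) (x : X), (inr b : A ∗ B) • x = b • x) (g : A ∗ B) (x : X) :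
    kuroshHom p (kuroshCocycle sA sB g x) = (p (g • x))⁻¹ * g * p x := by
  induction g using induction_on generalizing x with
  | inl a =>
    have h1 := h.left (a • x)
    rw [OrbitSection.mk_smul] at h1
    rw [kuroshCocycle_inl, OrbitSection.cocycle, Pi.one_apply, Pi.one_apply, one_mul, inv_one,
      mul_one, kuroshHom_left, hA, h1, h.left x]
    simp only [map_mul, map_inv]
    group
  | inr b =>
    rw [kuroshCocycle_inr, OrbitSection.cocycle, map_mul, map_mul, map_inv,
      kuroshHom_edgeValue h, kuroshHom_edgeValue h, kuroshHom_right, hB, OrbitSection.mk_smul]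
    simp only [map_mul, map_inv]
    group
  | mul g k hg hk =>
    rw [kuroshCocycle_mul sA sB hA hB, map_mul, hg, hk, mul_smul]
    group

/-- The Kurosh subgroup theorem, relative to a system of paths. -/
theorem nonempty_stabilizer_mulEquiv [MulAction (A ∗ B) X]
    {x₀ : X} {p : X → A ∗ B} (h : IsPathSystem sA sB x₀ p)
    (hA : ∀ (a : A) (x : X), (inl a : A ∗ B) • x = a • x)
    (hB : ∀ (b : B) (x : X), (inr b : A ∗ B) • x = b • x)
    (hp : ∀ x, p x • x₀ = x) (hc : ∀ x, kuroshCocycle sA sB (p x) x₀ = 1) :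
    Nonempty (MulAction.stabilizer (A ∗ B) x₀ ≃* KuroshProduct sA sB) := by
  have hinv : ∀ x, (p x)⁻¹ • x = x₀ := fun x => by rw [inv_smul_eq_iff, hp]
  have hci : ∀ x, kuroshCocycle sA sB (p x)⁻¹ x = 1 := by
    intro x
    have := kuroshCocycle_mul sA sB hA hB (p x)⁻¹ (p x) x₀
    rwa [inv_mul_cancel, kuroshCocycle_one, hp, hc, mul_one, eq_comm] at this
  -- Closing up an arrow by paths with trivial cocycle gives a loop at `x₀` with the same value, so
  -- every value of the cocycle comes from the stabilizer.
  have hconj : ∀ (x y : X) (g : A ∗ B), g • y = x →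
      ((p x)⁻¹ * g * p y) • x₀ = x₀ ∧
      kuroshCocycle sA sB ((p x)⁻¹ * g * p y) x₀ = kuroshCocycle sA sB g y := by
    intro x y g hg
    rw [kuroshCocycle_mul sA sB hA hB, kuroshCocycle_mul sA sB hA hB, hp, hg, hci, hc,
      mul_smul, mul_smul, hp, hg, hinv]
    simp
  let Φ : MulAction.stabilizer (A ∗ B) x₀ →* KuroshProduct sA sB :=
    { toFun := fun g => kuroshCocycle sA sB g x₀
      map_one' := kuroshCocycle_one sA sB x₀
      map_mul' := fun g k => by
        rw [Subgroup.coe_mul, kuroshCocycle_mul sA sB hA hB, k.2] }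
  have hinj : Function.Injective Φ := by
    intro g k hgk
    have key : ∀ g : MulAction.stabilizer (A ∗ B) x₀, kuroshHom p (Φ g) = g := by
      intro g
      have hg : (g : A ∗ B) • x₀ = x₀ := g.2
      change kuroshHom p (kuroshCocycle sA sB g x₀) = g
      rw [kuroshHom_cocycle h hA hB, hg, h.base]
      simp
    exact Subtype.ext (by rw [← key g, hgk, key])
  have hrange : ∀ (x y : X) (g : A ∗ B), g • y = x → kuroshCocycle sA sB g y ∈ Φ.range := by
    intro x y g hg
    obtain ⟨h1, h2⟩ := hconj x y g hg
    exact ⟨⟨_, h1⟩, h2⟩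
  -- The three kinds of generators of the Kurosh product are cocycle values: loops at base points of
  -- either kind, and chosen `B`-paths to extra edges.
  have hleft : ∀ ω a, kuroshLeft sA sB ω a ∈ Φ.range := by
    intro ω a
    have := hrange _ (sA.rep ω) (inl a) rfl
    rwa [kuroshCocycle_inl, OrbitSection.cocycle_rep, Pi.one_apply, one_mul, inv_one,
      mul_one] at this
  have hright : ∀ ω b, kuroshRight sA sB ω b ∈ Φ.range := by
    intro ω b
    have := hrange _ (sB.rep ω) (inr b) rfl
    rwa [kuroshCocycle_inr, OrbitSection.cocycle_rep, edgeValue,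
      dif_neg (fun hx => hx.2 ⟨ω, rfl⟩), one_mul, inv_one, mul_one] at this
  have hfree : ∀ x, (inr (FreeGroup.of x) : KuroshProduct sA sB) ∈ Φ.range := by
    intro x
    have := hrange _ (sB.rep (Quotient.mk'' (x : X))) (inr (sB.tr x)) rfl
    rwa [kuroshCocycle_inr, OrbitSection.cocycle_tr, edgeValue, edgeValue, dif_pos x.2,
      dif_neg (fun hx => hx.2 ⟨_, rfl⟩), inv_one, mul_one] at this
  have hsurj : Function.Surjective Φ := by
    intro q
    change q ∈ Φ.range
    induction q using induction_on with
    | inl q =>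
      induction q using induction_on with
      | inl q =>
        induction q using CoprodI.induction_on with
        | one => simp
        | of ω a => exact hleft ω a
        | mul x y hx hy => rw [map_mul, map_mul]; exact mul_mem hx hy
      | inr q =>
        induction q using CoprodI.induction_on with
        | one => simp
        | of ω a => exact hright ω a
        | mul x y hx hy => rw [map_mul, map_mul]; exact mul_mem hx hy
      | mul x y hx hy => rw [map_mul]; exact mul_mem hx hy
    | inr q =>
      induction q using FreeGroup.induction_on with
      | C1 => simp
      | of x => exact hfree x
      | inv_of x hx => rw [map_inv]; exact inv_mem hx
      | mul x y hx hy => rw [map_mul]; exact mul_mem hx hy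
    | mul x y hx hy => exact mul_mem hx hy
  exact ⟨MulEquiv.ofBijective Φ ⟨hinj, hsurj⟩⟩

/-- Base points that minimize the length give rise to a system of paths. -/
theorem exists_isPathSystem {x₀ : X} {ℓ : X → ℕ}
    (hℓ : ∀ x, x ≠ x₀ → (∃ a : A, ℓ (a • x) < ℓ x) ∨ ∃ b : B, ℓ (b • x) < ℓ x)
    (hmA : ∀ x, ℓ (sA.rep (Quotient.mk'' x)) ≤ ℓ x)
    (hmB : ∀ x, ℓ (sB.rep (Quotient.mk'' x)) ≤ ℓ x) :
    Set.range sA.rep ∩ Set.range sB.rep = {x₀} ∧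
    ∃ p : X → A ∗ B, IsPathSystem sA sB x₀ p ∧ ∀ Q : X → Prop, Q x₀ →
      (∀ x, Q (sA.rep (Quotient.mk'' x)) → Q x) →
      (∀ x, x ∉ extraEdges sA sB → Q (sB.rep (Quotient.mk'' x)) → Q x) → ∀ x, Q x := by
  classical
  have hrA : ∀ {x}, x ∈ Set.range sA.rep → sA.rep (Quotient.mk'' x) = x := by
    rintro _ ⟨ω, rfl⟩; rw [sA.mk_rep]
  have hrB : ∀ {x}, x ∈ Set.range sB.rep → sB.rep (Quotient.mk'' x) = x := by
    rintro _ ⟨ω, rfl⟩; rw [sB.mk_rep]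
  have htA : ∀ {x}, x ∈ Set.range sA.rep → sA.tr x = 1 := by
    rintro _ ⟨ω, rfl⟩; rw [sA.tr_rep]
  have htB : ∀ {x}, x ∈ Set.range sB.rep → sB.tr x = 1 := by
    rintro _ ⟨ω, rfl⟩; rw [sB.tr_rep]
  have hlA : ∀ x, x ∈ Set.range sA.rep → ∀ a : A, ℓ x ≤ ℓ (a • x) := by
    intro x hx a
    have := hmA (a • x)
    rwa [OrbitSection.mk_smul, hrA hx] at this
  have hlB : ∀ x, x ∈ Set.range sB.rep → ∀ b : B, ℓ x ≤ ℓ (b • x) := by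
    intro x hx b
    have := hmB (b • x)
    rwa [OrbitSection.mk_smul, hrB hx] at this
  -- Repeated descent can only stop at `x₀`, which is therefore the unique point of least length.
  have hmin : ∀ n y, ℓ y = n → y ≠ x₀ → ℓ x₀ < ℓ y := by
    intro n
    induction n using Nat.strong_induction_on with
    | _ n ih =>
      rintro y rfl hy
      obtain ⟨z, hz⟩ : ∃ z, ℓ z < ℓ y := by
        rcases hℓ y hy with ⟨a, ha⟩ | ⟨b, hb⟩
        exacts [⟨_, ha⟩, ⟨_, hb⟩]
      by_cases hzx : z = x₀
      · rwa [hzx] at hz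
      · exact (ih _ hz z rfl hzx).trans hz
  have hA₀ : sA.rep (Quotient.mk'' x₀) = x₀ := by
    by_contra h
    exact absurd (hmA x₀) (not_le.2 (hmin _ _ rfl h))
  have hB₀ : sB.rep (Quotient.mk'' x₀) = x₀ := by
    by_contra h
    exact absurd (hmB x₀) (not_le.2 (hmin _ _ rfl h))
  -- A base point for both factors is a local minimum of the length, so it is `x₀`. This is what
  -- makes the base points the edges of a spanning tree.
  have hcap : Set.range sA.rep ∩ Set.range sB.rep = {x₀} := by
    ext x
    refine ⟨fun ⟨h1, h2⟩ => ?_, ?_⟩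
    · by_contra h
      rcases hℓ x h with ⟨a, ha⟩ | ⟨b, hb⟩
      · exact absurd (hlA x h1 a) (not_le.2 ha)
      · exact absurd (hlB x h2 b) (not_le.2 hb)
    · rintro rfl
      exact ⟨⟨_, hA₀⟩, ⟨_, hB₀⟩⟩
  have hdec : ∀ x, x ∈ Set.range sA.rep → x ≠ x₀ → ℓ (sB.rep (Quotient.mk'' x)) < ℓ x := by
    intro x hx hx₀
    rcases hℓ x hx₀ with ⟨a, ha⟩ | ⟨b, hb⟩
    · exact absurd (hlA x hx a) (not_le.2 ha)
    · have := hmB (b • x)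
      rw [OrbitSection.mk_smul] at this
      exact this.trans_lt hb
  -- Passing to the `A`-base point may keep the length and only gains the last summand. Passing on
  -- to the `B`-base point may lose that summand but shortens the length; the factor 2 makes the
  -- shortening prevail.
  let μ : X → ℕ := fun x => 2 * ℓ x + if x ∈ Set.range sA.rep then 0 else 1
  have hμ1 : ∀ x, x ∈ Set.range sA.rep → x ≠ x₀ → μ (sB.rep (Quotient.mk'' x)) < μ x := by
    intro x hx hx₀
    have := hdec x hx hx₀
    simp only [μ, if_pos hx]
    split_ifs <;> omega
  have hμ2 : ∀ x, x ∉ Set.range sA.rep → μ (sA.rep (Quotient.mk'' x)) < μ x := by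
    intro x hx
    have := hmA x
    have h' : sA.rep (Quotient.mk'' x) ∈ Set.range sA.rep := ⟨_, rfl⟩
    simp only [μ, if_neg hx, if_pos h']
    omega
  let F : ∀ x, (∀ y, μ y < μ x → A ∗ B) → A ∗ B := fun x rec =>
    if h : x ∈ Set.range sA.rep then
      if h₀ : x = x₀ then 1 else inr (sB.tr x) * rec _ (hμ1 x h h₀)
    else inl (sA.tr x) * rec _ (hμ2 x h)
  let p : X → A ∗ B := (measure μ).wf.fix F
  have hpF : ∀ x, p x = F x fun y _ => p y := fun x => (measure μ).wf.fix_eq F x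
  have hp0 : p x₀ = 1 := by
    rw [hpF]
    exact (dif_pos ⟨_, hA₀⟩).trans (dif_pos rfl)
  have hp1 : ∀ x, x ∈ Set.range sA.rep → x ≠ x₀ →
      p x = inr (sB.tr x) * p (sB.rep (Quotient.mk'' x)) := by
    intro x hx hx₀
    rw [hpF]
    simp only [F]
    rw [dif_pos hx, dif_neg hx₀]
  have hp2 : ∀ x, x ∉ Set.range sA.rep → p x = inl (sA.tr x) * p (sA.rep (Quotient.mk'' x)) := by
    intro x hx
    rw [hpF]
    simp only [F]
    rw [dif_neg hx]
  refine ⟨hcap, p, ⟨hp0, fun x => ?_, fun x hx => ?_⟩, ?_⟩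
  · by_cases h : x ∈ Set.range sA.rep
    · rw [htA h, hrA h, map_one, one_mul]
    · exact hp2 x h
  · by_cases h : x ∈ Set.range sB.rep
    · rw [htB h, hrB h, map_one, one_mul]
    · have hxA : x ∈ Set.range sA.rep := by
        by_contra h'
        exact hx ⟨h', h⟩
      refine hp1 x hxA ?_
      rintro rfl
      exact h ⟨_, hB₀⟩
  · intro Q h0 hQA hQB x
    induction x using (measure μ).wf.induction with
    | _ x ih =>
      by_cases h : x ∈ Set.range sA.rep
      · by_cases hx₀ : x = x₀
        · rwa [hx₀]
        · exact hQB x (fun hx => hx.1 h) (ih _ (hμ1 x h hx₀))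
      · exact hQA x (ih _ (hμ2 x h))

variable (A B) in
/-- The Kurosh subgroup theorem for a subgroup of finite index of a free product, written as the
stabilizer of a point `x₀` of a finite transitive set `X`. -/
theorem exists_stabilizer_mulEquiv [MulAction (A ∗ B) X] [MulAction.IsPretransitive (A ∗ B) X]
    [Finite X]
    (hA : ∀ (a : A) (x : X), (inl a : A ∗ B) • x = a • x)
    (hB : ∀ (b : B) (x : X), (inr b : A ∗ B) • x = b • x) (x₀ : X) :
    ∃ (sA : OrbitSection A X) (sB : OrbitSection B X),
      Nat.card (MulAction.orbitRel.Quotient A X) + Nat.card (MulAction.orbitRel.Quotient B X) +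
        Nat.card (extraEdges sA sB) = Nat.card X + 1 ∧
      Nonempty (MulAction.stabilizer (A ∗ B) x₀ ≃* KuroshProduct sA sB) := by
  obtain ⟨ℓ, hℓ⟩ := exists_length hA hB x₀
  obtain ⟨sA, hmA⟩ := OrbitSection.exists_minimal (K := A) ℓ
  obtain ⟨sB, hmB⟩ := OrbitSection.exists_minimal (K := B) ℓ
  obtain ⟨hcap, p, hp, hind⟩ := exists_isPathSystem hℓ hmA hmB
  refine ⟨sA, sB, ?_, ?_⟩
  -- Inclusion-exclusion: the two sets of base points share one point, and the extra edges are the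
  -- complement of their union.
  · have h1 : (Set.range sA.rep).ncard = Nat.card (MulAction.orbitRel.Quotient A X) :=
      Nat.card_range_of_injective sA.rep_injective
    have h2 : (Set.range sB.rep).ncard = Nat.card (MulAction.orbitRel.Quotient B X) :=
      Nat.card_range_of_injective sB.rep_injective
    have h3 := Set.ncard_union_add_ncard_inter (Set.range sA.rep) (Set.range sB.rep)
      (Set.toFinite _) (Set.toFinite _)
    have h4 := Set.ncard_add_ncard_compl (Set.range sA.rep ∪ Set.range sB.rep)
    have h5 : (Set.range sA.rep ∪ Set.range sB.rep)ᶜ = extraEdges sA sB := by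
      ext x; simp [extraEdges]
    rw [hcap, Set.ncard_singleton] at h3
    rw [h5, ← Nat.card_coe_set_eq (extraEdges sA sB)] at h4
    omega
  · have hsm : ∀ x, p x • x₀ = x := by
      refine hind _ (by rw [hp.base, one_smul]) (fun x hx => ?_) (fun x hxE hx => ?_)
      · rw [hp.left, mul_smul, hx, hA, sA.tr_smul]
      · rw [hp.right x hxE, mul_smul, hx, hB, sB.tr_smul]
    refine nonempty_stabilizer_mulEquiv hp hA hB hsm ?_
    -- Paths in the tree use only steps on which the cocycle is trivial.
    refine hind _ (by rw [hp.base, kuroshCocycle_one]) (fun x hx => ?_) (fun x hxE hx => ?_)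
    · rw [hp.left, kuroshCocycle_mul sA sB hA hB, hx, hsm, kuroshCocycle_inl,
        OrbitSection.cocycle_tr]
      simp
    · rw [hp.right x hxE, kuroshCocycle_mul sA sB hA hB, hx, hsm, kuroshCocycle_inr,
        OrbitSection.cocycle_tr, edgeValue, edgeValue, dif_neg hxE,
        dif_neg (fun hx => hx.2 ⟨_, rfl⟩)]
      simp

end Kurosh

end Monoid.Coprod

/-! ### Free products of families -/

namespace Monoid.CoprodI

/-- A free product can be reindexed. -/
theorem nonempty_reindex {ι κ : Type*} (e : ι ≃ κ) (W : κ → Type*) [∀ k, Group (W k)] :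
    Nonempty (CoprodI (fun i => W (e i)) ≃* CoprodI W) := by
  let f : CoprodI (fun i => W (e i)) →* CoprodI W := lift fun i => of (M := W) (i := e i)
  -- The inclusion at `e.symm k` has the right type only after a transport, which
  -- `Equiv.piCongrLeft` performs.
  let φ : ∀ k, W k →* CoprodI (fun i => W (e i)) :=
    Equiv.piCongrLeft (fun k => W k →* CoprodI (fun i => W (e i))) e
      fun i => of (M := fun i => W (e i)) (i := i)
  have hφ : ∀ i, φ (e i) = of (M := fun i => W (e i)) (i := i) := fun i =>
    Equiv.piCongrLeft_apply_apply (fun k => W k →* CoprodI (fun i => W (e i))) e _ i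
  refine ⟨MonoidHom.toMulEquiv f (lift φ) ?_ ?_⟩
  · refine ext_hom _ _ fun i => MonoidHom.ext fun w => ?_
    simp [f, hφ]
  · refine ext_hom _ _ fun k => MonoidHom.ext fun w => ?_
    obtain ⟨i, rfl⟩ := e.surjective k
    simp [f, hφ]

/-- Splitting off one factor from a free product. -/
theorem nonempty_option {ι : Type*} (W : Option ι → Type*) [∀ k, Group (W k)] :
    Nonempty (W none ∗ CoprodI (fun i => W (some i)) ≃* CoprodI W) := by
  let f : W none ∗ CoprodI (fun i => W (some i)) →* CoprodI W :=
    Coprod.lift (of (M := W) (i := none)) (lift fun i => of (M := W) (i := some i))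
  let φ : ∀ k, W k →* W none ∗ CoprodI (fun i => W (some i)) := fun k =>
    match k with
    | none => Coprod.inl
    | some i => Coprod.inr.comp (of (M := fun i => W (some i)) (i := i))
  refine ⟨MonoidHom.toMulEquiv f (lift φ) ?_ ?_⟩
  · refine Coprod.hom_ext (MonoidHom.ext fun w => ?_)
      (ext_hom _ _ fun i => MonoidHom.ext fun w => ?_)
    · simp [f, φ]
    · simp [f, φ]
  · refine ext_hom _ _ fun k => MonoidHom.ext fun w => ?_
    rcases k with _ | i
    · simp [f, φ]
    · simp [f, φ]

/-- A free group is a free product of infinite cyclic groups. -/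
theorem nonempty_freeGroup (ι : Type u) :
    Nonempty (CoprodI (fun _ : ι => InfCyclic.{u}) ≃* FreeGroup ι) := by
  let f : CoprodI (fun _ : ι => InfCyclic.{u}) →* FreeGroup ι :=
    lift fun i => (zpowersHom _ (FreeGroup.of i)).comp MulEquiv.ulift.toMonoidHom
  let g : FreeGroup ι →* CoprodI (fun _ : ι => InfCyclic.{u}) :=
    FreeGroup.lift fun i => of (M := fun _ : ι => InfCyclic.{u}) (i := i)
      (ULift.up (Multiplicative.ofAdd 1))
  have hu : ∀ w, MulEquiv.ulift (ULift.up w : InfCyclic.{u}) = w := fun _ => rfl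
  refine ⟨MonoidHom.toMulEquiv f g ?_ ?_⟩
  · refine ext_hom _ _ fun i => MonoidHom.ext fun w => ?_
    obtain ⟨w⟩ := w
    have : (ULift.up w : InfCyclic.{u}) = (ULift.up (Multiplicative.ofAdd 1)) ^ w.toAdd := by
      ext
      simp [← ofAdd_zsmul]
    rw [this]
    simp [f, g, hu]
  · ext i
    simp [f, g, hu]

end Monoid.CoprodI

/-! ### Subadditive invariants and the bound from Kurosh -/

open Monoid Monoid.Coprod

/-- A class of groups that contains the trivial groups and the infinite cyclic group and is closed
under free products, with a subadditive invariant. -/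
structure IsFreelySubadditive (D : GroupClass.{u}) (f : GroupInvariant.{u}) : Prop where
  iso : D.IsoClosed
  coprod : D.FreeProductClosed
  trivial : ∀ (G : Type u) [Group G], Subsingleton G → D G ∧ f G = 0
  cyclic : D InfCyclic
  invariant : f.IsoInvariantOn D
  subadd : ∀ (A B : Type u) [Group A] [Group B], D A → D B → f (A ∗ B) ≤ f A + f B

namespace IsFreelySubadditive

variable {D : GroupClass.{u}} {f : GroupInvariant.{u}}

theorem of_equiv (h : IsFreelySubadditive D f) {G H : Type u} [Group G] [Group H]
    (e : Nonempty (G ≃* H)) {r : ℝ} (hG : D G ∧ f G ≤ r) : D H ∧ f H ≤ r :=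
  have hH := h.iso G H hG.1 e
  ⟨hH, (h.invariant G H hG.1 hH e).symm.trans_le hG.2⟩

theorem coprod_le (h : IsFreelySubadditive D f) {A B : Type u} [Group A] [Group B] {r s : ℝ}
    (hA : D A ∧ f A ≤ r) (hB : D B ∧ f B ≤ s) : D (A ∗ B) ∧ f (A ∗ B) ≤ r + s :=
  ⟨h.coprod A B hA.1 hB.1, (h.subadd A B hA.1 hB.1).trans (add_le_add hA.2 hB.2)⟩

theorem coprodI_le (h : IsFreelySubadditive D f) (ι : Type u) [Finite ι] :
    ∀ [Fintype ι] (W : ι → Type u) [∀ i, Group (W i)] (r : ι → ℝ),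
      (∀ i, D (W i) ∧ f (W i) ≤ r i) → D (CoprodI W) ∧ f (CoprodI W) ≤ ∑ i, r i := by
  refine Finite.induction_empty_option
    (P := fun ι : Type u => ∀ [Fintype ι] (W : ι → Type u) [∀ i, Group (W i)] (r : ι → ℝ),
      (∀ i, D (W i) ∧ f (W i) ≤ r i) → D (CoprodI W) ∧ f (CoprodI W) ≤ ∑ i, r i)
    ?_ ?_ ?_ ι
  · intro α β e ih _ W _ r hW
    have := Fintype.ofEquiv β e.symm
    have := ih (fun i => W (e i)) (fun i => r (e i)) fun i => hW (e i)
    rw [e.sum_comp r] at this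
    exact h.of_equiv (CoprodI.nonempty_reindex e W) this
  · intro _ W _ r hW
    -- On an empty free product the identity and the trivial homomorphism coincide.
    have hs : Subsingleton (CoprodI W) :=
      ⟨fun x y => DFunLike.congr_fun
        (CoprodI.ext_hom (MonoidHom.id (CoprodI W)) 1 fun i => i.elim) x |>.trans
        (DFunLike.congr_fun
          (CoprodI.ext_hom (MonoidHom.id (CoprodI W)) 1 fun i => i.elim) y).symm⟩
    obtain ⟨h1, h2⟩ := h.trivial (CoprodI W) hs
    exact ⟨h1, by rw [h2]; simp⟩
  · intro α _ ih _ W _ r hW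
    have := Fintype.ofFinite α
    have := ih (fun i => W (some i)) (fun i => r (some i)) fun i => hW (some i)
    have h2 := h.of_equiv (CoprodI.nonempty_option W) (h.coprod_le (hW none) this)
    have h3 : ∑ i, r i = r none + ∑ i, r (some i) := by
      rw [← Fintype.sum_option]
      exact Finset.sum_congr (by ext; simp) fun _ _ => rfl
    rwa [h3]

theorem freeGroup_le (h : IsFreelySubadditive D f) (ι : Type u) [Finite ι] :
    D (FreeGroup ι) ∧ f (FreeGroup ι) ≤ Nat.card ι * f InfCyclic := by
  have := Fintype.ofFinite ι
  have := h.of_equiv (CoprodI.nonempty_freeGroup ι)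
    (h.coprodI_le ι (fun _ => InfCyclic.{u}) (fun _ => f InfCyclic) fun _ => ⟨h.cyclic, le_rfl⟩)
  simpa [Nat.card_eq_fintype_card] using this

end IsFreelySubadditive

/-- The free product of the stabilizers of all base points inherits a linear bound in the index. -/
theorem IsFreelySubadditive.coprodI_stabilizer_le {D : GroupClass.{u}} {f : GroupInvariant.{u}}
    (h : IsFreelySubadditive D f) {K X : Type u} [Group K] [MulAction K X] [Finite X]
    (s : OrbitSection K X) {c e : ℝ}
    (hs : ∀ x : X, D (MulAction.stabilizer K x) ∧
      f (MulAction.stabilizer K x) ≤ c * (MulAction.stabilizer K x).index + e) :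
    D (CoprodI fun ω => MulAction.stabilizer K (s.rep ω)) ∧
      f (CoprodI fun ω => MulAction.stabilizer K (s.rep ω)) ≤
        c * Nat.card X + e * Nat.card (MulAction.orbitRel.Quotient K X) := by
  have := Fintype.ofFinite (MulAction.orbitRel.Quotient K X)
  have h1 := h.coprodI_le (MulAction.orbitRel.Quotient K X)
    (fun ω => MulAction.stabilizer K (s.rep ω))
    (fun ω => c * (MulAction.stabilizer K (s.rep ω)).index + e) fun ω => hs (s.rep ω)
  -- Orbit decomposition: the indices of the stabilizers are the sizes of the orbits.
  have h2 : Nat.card X = ∑ ω, (MulAction.stabilizer K (s.rep ω)).index := by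
    have hfin : ∀ ω, Finite (K ⧸ MulAction.stabilizer K (s.rep ω)) := fun ω =>
      Finite.of_equiv _ (MulAction.orbitEquivQuotientStabilizer K (s.rep ω))
    rw [Nat.card_congr (MulAction.selfEquivSigmaOrbitsQuotientStabilizer' K X s.mk_rep),
      Nat.card_sigma]
    rfl
  refine ⟨h1.1, h1.2.trans_eq ?_⟩
  rw [h2, Finset.sum_add_distrib, ← Finset.mul_sum]
  simp [Nat.card_eq_fintype_card, mul_comm]

/-- The bound on a subgroup of finite index in a free product that follows from the Kurosh subgroup
theorem. -/
theorem IsFreelySubadditive.subgroup_le {D : GroupClass.{u}} {f : GroupInvariant.{u}}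
    (h : IsFreelySubadditive D f) {A B : Type u} [Group A] [Group B] (H : Subgroup (A ∗ B))
    [H.FiniteIndex] {a b : ℝ}
    (hA : ∀ g : A ∗ B, ∀ S : Subgroup A, (∀ k, k ∈ S ↔ g⁻¹ * inl k * g ∈ H) →
      D S ∧ f S ≤ a * S.index + f InfCyclic)
    (hB : ∀ g : A ∗ B, ∀ S : Subgroup B, (∀ k, k ∈ S ↔ g⁻¹ * inr k * g ∈ H) →
      D S ∧ f S ≤ b * S.index + f InfCyclic) :
    D H ∧ f H ≤ (a + b) * H.index + f InfCyclic * (H.index + 1) := by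
  let _ : MulAction A ((A ∗ B) ⧸ H) := MulAction.compHom _ (inl : A →* A ∗ B)
  let _ : MulAction B ((A ∗ B) ⧸ H) := MulAction.compHom _ (inr : B →* A ∗ B)
  have hmem : ∀ g k : A ∗ B, k • (g : (A ∗ B) ⧸ H) = g ↔ g⁻¹ * k * g ∈ H := by
    intro g k
    rw [eq_comm, MulAction.Quotient.smul_coe, QuotientGroup.eq, smul_eq_mul, mul_assoc]
  obtain ⟨sA, sB, hcard, he⟩ := exists_stabilizer_mulEquiv A B (X := (A ∗ B) ⧸ H)
    (fun _ _ => rfl) (fun _ _ => rfl) ((1 : A ∗ B) : (A ∗ B) ⧸ H)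
  have h1 := h.coprodI_stabilizer_le sA (c := a) (e := f InfCyclic) fun x => by
    obtain ⟨g, rfl⟩ := QuotientGroup.mk_surjective x
    exact hA g _ fun k => hmem g (inl k)
  have h2 := h.coprodI_stabilizer_le sB (c := b) (e := f InfCyclic) fun x => by
    obtain ⟨g, rfl⟩ := QuotientGroup.mk_surjective x
    exact hB g _ fun k => hmem g (inr k)
  have h3 := h.of_equiv ⟨he.some.symm⟩
    (h.coprod_le (h.coprod_le h1 h2) (h.freeGroup_le (extraEdges sA sB)))
  rw [MulAction.stabilizer_quotient] at h3
  refine ⟨h3.1, h3.2.trans_eq ?_⟩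
  -- Every stabilizer and every free generator contributes one `f InfCyclic`; the Kurosh count adds
  -- these up to `H.index + 1`.
  have hcard' : (Nat.card (MulAction.orbitRel.Quotient A ((A ∗ B) ⧸ H)) : ℝ) +
      Nat.card (MulAction.orbitRel.Quotient B ((A ∗ B) ⧸ H)) + Nat.card (extraEdges sA sB) =
      H.index + 1 := by
    exact_mod_cast hcard
  have hidx : (Nat.card ((A ∗ B) ⧸ H) : ℝ) = H.index := rfl
  rw [hidx, ← hcard']
  ring

/-! ### The volume as an upper limit -/

section Volume

variable {τ : GroupInvariant.{u}} {G : Type u} [Group G]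

theorem sigmaVolume_le {r : ℝ} (H : Subgroup G) (hH : H.FiniteIndex)
    (h : ∀ K : Subgroup G, K.FiniteIndex → K ≤ H → τ K / (K.index : ℝ) ≤ r) :
    sigmaVolume τ G ≤ r :=
  iInf₂_le_of_le H hH (iSup_le fun K => iSup₂_le fun hK hKH => EReal.coe_le_coe (h K hK hKH))

theorem exists_of_sigmaVolume_lt {r : ℝ} (h : sigmaVolume τ G < r) :
    ∃ H : Subgroup G, H.FiniteIndex ∧
      ∀ K : Subgroup G, K.FiniteIndex → K ≤ H → τ K / (K.index : ℝ) ≤ r := by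
  obtain ⟨H, h⟩ := iInf_lt_iff.1 h
  obtain ⟨hH, h⟩ := iInf_lt_iff.1 h
  refine ⟨H, hH, fun K hK hKH => EReal.coe_le_coe_iff.1 (le_trans ?_ h.le)⟩
  exact le_iSup_of_le K (le_iSup₂_of_le hK hKH le_rfl)

theorem le_sigmaVolume {r : ℝ}
    (h : ∀ H : Subgroup G, H.FiniteIndex → ∃ K : Subgroup G, K.FiniteIndex ∧ K ≤ H ∧
      r ≤ τ K / (K.index : ℝ)) : r ≤ sigmaVolume τ G := by
  refine le_iInf₂ fun H hH => ?_
  obtain ⟨K, hK, hKH, hr⟩ := h H hH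
  exact le_iSup_of_le K (le_iSup₂_of_le hK hKH (EReal.coe_le_coe hr))

theorem exists_of_lt_sigmaVolume {r : ℝ} (h : r < sigmaVolume τ G) (H : Subgroup G)
    (hH : H.FiniteIndex) : ∃ K : Subgroup G, K.FiniteIndex ∧ K ≤ H ∧
      r < τ K / (K.index : ℝ) := by
  have h := lt_of_lt_of_le h (iInf₂_le H hH)
  obtain ⟨K, h⟩ := lt_iSup_iff.1 h
  obtain ⟨hK, h⟩ := lt_iSup_iff.1 h
  obtain ⟨hKH, h⟩ := lt_iSup_iff.1 h
  exact ⟨K, hK, hKH, EReal.coe_lt_coe_iff.1 h⟩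

theorem index_pos (H : Subgroup G) (hH : H.FiniteIndex) : (0 : ℝ) < H.index :=
  Nat.cast_pos.2 (Nat.pos_of_ne_zero hH.index_ne_zero)

variable {D : GroupClass.{u}}

theorem GroupClass.mem_of_le (hDi : D.IsoClosed) (hDf : D.FiniteIndexClosed) {K M : Subgroup G}
    (hK : D K) (hM : M.FiniteIndex) (hMK : M ≤ K) : D M :=
  hDi (M.subgroupOf K) M (hDf K (M.subgroupOf K) hK inferInstance)
    ⟨Subgroup.subgroupOfEquivOfLe hMK⟩

/-- Invariants of a subgroup do not depend on the ambient group. -/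
theorem GroupInvariant.div_index_subgroupOf (hDi : D.IsoClosed) (hDf : D.FiniteIndexClosed)
    (hτ : τ.IsoInvariantOn D) {K M : Subgroup G} (hK : D K) (hKf : K.FiniteIndex)
    (hM : M.FiniteIndex) (hMK : M ≤ K) :
    τ (M.subgroupOf K) / ((M.subgroupOf K).index : ℝ) = τ M / (M.index : ℝ) * K.index := by
  rw [hτ (M.subgroupOf K) M (hDf K (M.subgroupOf K) hK inferInstance)
    (GroupClass.mem_of_le hDi hDf hK hM hMK) ⟨Subgroup.subgroupOfEquivOfLe hMK⟩]
  have h1 : ((M.subgroupOf K).index : ℝ) * K.index = M.index := by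
    exact_mod_cast Subgroup.relIndex_mul_index hMK
  have h2 := index_pos K hKf
  have h3 := index_pos M hM
  have h4 : ((M.subgroupOf K).index : ℝ) ≠ 0 := by
    intro h0; rw [h0, zero_mul] at h1; exact h3.ne h1
  rw [← h1]
  field_simp

/-- The volume is multiplicative with respect to the index. -/
theorem sigmaVolume_eq_div (hDi : D.IsoClosed) (hDf : D.FiniteIndexClosed)
    (hτ : τ.IsoInvariantOn D) (K : Subgroup G) (hKf : K.FiniteIndex) (hK : D K) :
    sigmaVolume τ G = sigmaVolume τ K / ((K.index : ℝ) : EReal) := by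
  have hpos := index_pos K hKf
  have hpos' : (0 : EReal) < ((K.index : ℝ) : EReal) := by exact_mod_cast hpos
  -- Subgroups of finite index inside `K` are cofinal among those of `G`, and seen from `K` their
  -- ratios are multiplied by `K.index`.
  refine le_antisymm ?_ ?_
  · refine EReal.le_of_forall_lt_iff_le.1 fun z hz => ?_
    rw [EReal.div_lt_iff hpos' (EReal.coe_ne_top _), ← EReal.coe_mul] at hz
    obtain ⟨H, hH, h⟩ := exists_of_sigmaVolume_lt hz
    have hHm : (H.map K.subtype).FiniteIndex := ⟨by
      rw [Subgroup.index_map_subtype]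
      exact mul_ne_zero hH.index_ne_zero hKf.index_ne_zero⟩
    refine sigmaVolume_le (H.map K.subtype) hHm fun M hM hMH => ?_
    have hMK : M ≤ K := hMH.trans (Subgroup.map_subtype_le H)
    have h1 := h (M.subgroupOf K) inferInstance fun x hx => by
      obtain ⟨y, hy, hyx⟩ := hMH (Subgroup.mem_subgroupOf.1 hx)
      rwa [← Subtype.ext hyx]
    rw [GroupInvariant.div_index_subgroupOf hDi hDf hτ hK hKf hM hMK] at h1
    exact le_of_mul_le_mul_right h1 hpos
  · refine EReal.le_of_forall_lt_iff_le.1 fun z hz => ?_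
    obtain ⟨H, hH, h⟩ := exists_of_sigmaVolume_lt hz
    rw [EReal.div_le_iff_le_mul hpos' (EReal.coe_ne_top _), mul_comm, ← EReal.coe_mul]
    refine sigmaVolume_le (H.subgroupOf K) inferInstance fun L hL hLH => ?_
    have hM : (L.map K.subtype).FiniteIndex := ⟨by
      rw [Subgroup.index_map_subtype]
      exact mul_ne_zero hL.index_ne_zero hKf.index_ne_zero⟩
    have h1 := h (L.map K.subtype) hM (by
      rintro _ ⟨x, hx, rfl⟩
      exact Subgroup.mem_subgroupOf.1 (hLH hx))
    have h2 := GroupInvariant.div_index_subgroupOf hDi hDf hτ hK hKf hM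
      (Subgroup.map_subtype_le L)
    have h3 : (L.map K.subtype).subgroupOf K = L :=
      Subgroup.comap_map_eq_self_of_injective K.subtype_injective L
    rw [h3] at h2
    rw [h2]
    exact mul_le_mul_of_nonneg_right h1 hpos.le

/-- Boundedness of the nets keeps the upper limit away from `⊤` and `⊥`, so that the estimates can
be made with real numbers. -/
theorem exists_sigmaVolume_eq_coe (hDi : D.IsoClosed) (hDf : D.FiniteIndexClosed)
    (hτ : τ.IsoInvariantOn D) (hb : τ.BoundedNetsOn D) (hG : D.Virtually G) :
    ∃ v : ℝ, sigmaVolume τ G = v := by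
  obtain ⟨K, hKf, hK⟩ := hG
  obtain ⟨M, hM⟩ := hb K hK
  have h1 : sigmaVolume τ K ≤ (M : ℝ) := sigmaVolume_le ⊤ inferInstance fun L hL _ =>
    (abs_le.1 (hM L hL)).2
  have h2 : ((-M : ℝ) : EReal) ≤ sigmaVolume τ K := le_sigmaVolume fun L hL =>
    ⟨L, hL, le_rfl, (abs_le.1 (hM L hL)).1⟩
  lift sigmaVolume τ K to ℝ using
    ⟨(h1.trans_lt (EReal.coe_lt_top _)).ne, ((EReal.bot_lt_coe _).trans_le h2).ne'⟩ with v hv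
  exact ⟨v / K.index, by rw [sigmaVolume_eq_div hDi hDf hτ K hKf hK, ← hv, EReal.coe_div]⟩

end Volume

/-! ### Normalizing the invariant on trivial groups -/

section Normalization

/-- The class `C`, enlarged by the trivial groups. -/
def GroupClass.withTrivial (C : GroupClass.{u}) : GroupClass.{u} :=
  fun G _ => C G ∨ Subsingleton G

open Classical in
/-- The invariant `σ`, with the value `-1` on the trivial groups. -/
noncomputable def GroupInvariant.normalized (σ : GroupInvariant.{u}) : GroupInvariant.{u} :=
  fun G _ => if Subsingleton G then -1 else σ G

variable {C : GroupClass.{u}} {σ : GroupInvariant.{u}}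

theorem GroupInvariant.normalized_of_subsingleton (σ : GroupInvariant.{u}) (G : Type u) [Group G]
    (h : Subsingleton G) : σ.normalized G = -1 := if_pos h

theorem GroupInvariant.normalized_of_nontrivial (σ : GroupInvariant.{u}) (G : Type u) [Group G]
    (h : ¬ Subsingleton G) : σ.normalized G = σ G := if_neg h

theorem GroupClass.IsoClosed.withTrivial (hC : C.IsoClosed) : C.withTrivial.IsoClosed := by
  rintro G H _ _ (hG | hG) ⟨e⟩
  · exact Or.inl (hC G H hG ⟨e⟩)
  · exact Or.inr e.symm.injective.subsingleton

theorem GroupClass.FiniteIndexClosed.withTrivial (hC : C.FiniteIndexClosed) :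
    C.withTrivial.FiniteIndexClosed := by
  rintro G _ H (hG | hG) hH
  · exact Or.inl (hC G H hG hH)
  · exact Or.inr inferInstance

theorem GroupInvariant.IsoInvariantOn.normalized (hσ : σ.IsoInvariantOn C) :
    σ.normalized.IsoInvariantOn C.withTrivial := by
  rintro G H _ _ hG hH ⟨e⟩
  by_cases h : Subsingleton G
  · rw [σ.normalized_of_subsingleton G h, σ.normalized_of_subsingleton H
      e.symm.injective.subsingleton]
  · have h' : ¬ Subsingleton H := fun h' => h e.injective.subsingleton
    rw [σ.normalized_of_nontrivial G h, σ.normalized_of_nontrivial H h']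
    exact hσ G H (hG.resolve_right h) (hH.resolve_right h') ⟨e⟩

theorem GroupInvariant.BoundedNetsOn.normalized (hσ : σ.BoundedNetsOn C) :
    σ.normalized.BoundedNetsOn C.withTrivial := by
  intro G _ hG
  have key : ∀ H : Subgroup G, H.FiniteIndex → Subsingleton H →
      |σ.normalized H / (H.index : ℝ)| ≤ 1 := by
    intro H hH h
    have h1 : (1 : ℝ) ≤ H.index := by
      exact_mod_cast Nat.one_le_iff_ne_zero.2 hH.index_ne_zero
    rw [σ.normalized_of_subsingleton H h, abs_div, abs_neg, abs_one, Nat.abs_cast]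
    exact div_le_one_of_le₀ h1 (by positivity)
  rcases hG with hG | hG
  · obtain ⟨M, hM⟩ := hσ G hG
    refine ⟨max M 1, fun H hH => ?_⟩
    by_cases h : Subsingleton H
    · exact (key H hH h).trans (le_max_right _ _)
    · rw [σ.normalized_of_nontrivial H h]
      exact (hM H hH).trans (le_max_left _ _)
  · exact ⟨1, fun H hH => key H hH inferInstance⟩

theorem nonempty_coprod_left (A B : Type u) [Group A] [Group B] (h : Subsingleton A) :
    Nonempty (B ≃* A ∗ B) := by
  refine ⟨MonoidHom.toMulEquiv inr snd rfl (Coprod.hom_ext (MonoidHom.ext fun a => ?_)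
    (MonoidHom.ext fun b => ?_))⟩
  · rw [Subsingleton.elim a 1]; simp
  · simp

theorem nonempty_coprod_right (A B : Type u) [Group A] [Group B] (h : Subsingleton B) :
    Nonempty (A ≃* A ∗ B) :=
  ⟨(nonempty_coprod_left B A h).some.trans (MulEquiv.coprodComm B A)⟩

theorem GroupClass.FreeProductClosed.withTrivial (hCi : C.IsoClosed)
    (hC : C.FreeProductClosed) : C.withTrivial.FreeProductClosed := by
  intro A B _ _ hA hB
  by_cases hsA : Subsingleton A
  · exact hCi.withTrivial B _ hB (nonempty_coprod_left A B hsA)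
  by_cases hsB : Subsingleton B
  · exact hCi.withTrivial A _ hA (nonempty_coprod_right A B hsB)
  exact Or.inl (hC A B (hA.resolve_right hsA) (hB.resolve_right hsB))

theorem not_subsingleton_infCyclic : ¬ Subsingleton InfCyclic.{u} := fun h => by
  have : (ULift.up (Multiplicative.ofAdd (1 : ℤ)) : InfCyclic.{u}) = 1 := Subsingleton.elim _ _
  have h1 : Multiplicative.ofAdd (1 : ℤ) = 1 := congrArg ULift.down this
  exact absurd (ofAdd_eq_one.1 h1) one_ne_zero

/-- A one-sided bound on the values of `σ` on free products carries over to the normalized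
invariant; the sign `e` decides on the direction of the bound. -/
theorem isFreelySubadditive_normalized (hCi : C.IsoClosed) (hCf : C.FreeProductClosed)
    (hCZ : C InfCyclic) (hσ : σ.IsoInvariantOn C) (e : ℝ)
    (h : ∀ (A B : Type u) [Group A] [Group B], C A → C B →
      e * σ (A ∗ B) ≤ e * (σ A + σ B + 1)) :
    IsFreelySubadditive C.withTrivial (fun G _ => e * (σ.normalized G + 1)) where
  iso := hCi.withTrivial
  coprod := GroupClass.FreeProductClosed.withTrivial hCi hCf
  trivial G _ hG := ⟨Or.inr hG, by
    rw [σ.normalized_of_subsingleton G hG]; ring⟩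
  cyclic := Or.inl hCZ
  invariant := fun G H _ _ hG hH hGH => by
    simp only [hσ.normalized G H hG hH hGH]
  subadd A B _ _ hA hB := by
    have hAB := GroupClass.FreeProductClosed.withTrivial hCi hCf A B hA hB
    by_cases hsA : Subsingleton A
    · rw [← hσ.normalized B (A ∗ B) hB hAB (nonempty_coprod_left A B hsA),
        σ.normalized_of_subsingleton A hsA]
      apply le_of_eq; ring
    by_cases hsB : Subsingleton B
    · rw [← hσ.normalized A (A ∗ B) hA hAB (nonempty_coprod_right A B hsB),
        σ.normalized_of_subsingleton B hsB]
      apply le_of_eq; ring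
    have hsAB : ¬ Subsingleton (A ∗ B) := fun h =>
      hsA (inl_injective (M := A) (N := B)).subsingleton
    rw [σ.normalized_of_nontrivial A hsA, σ.normalized_of_nontrivial B hsB,
      σ.normalized_of_nontrivial _ hsAB]
    linarith [h A B (hA.resolve_right hsA) (hB.resolve_right hsB)]

/-- A subgroup of finite index in an infinite group is nontrivial, so the altered value never
enters. -/
theorem sigmaVolume_normalized_of_infinite (G : Type u) [Group G] (hG : ¬ Finite G) :
    sigmaVolume σ G = sigmaVolume σ.normalized G := by
  have : ∀ K : Subgroup G, K.FiniteIndex → σ.normalized K = σ K := fun K hK =>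
    σ.normalized_of_nontrivial K fun hs => hG (Nat.finite_of_card_ne_zero (by
      rw [← K.card_mul_index]
      exact mul_ne_zero (by simp) hK.index_ne_zero))
  unfold sigmaVolume
  refine iInf_congr fun H => iInf_congr fun _ => iSup_congr fun K => iSup_congr fun hK => ?_
  rw [this K hK]

theorem GroupClass.OrFinite.virtually_withTrivial (hCi : C.IsoClosed) {G : Type u} [Group G]
    (hG : C.OrFinite G) : C.withTrivial.Virtually G := by
  rcases hG with hG | hG
  · exact ⟨⊤, inferInstance, Or.inl (hCi G _ hG ⟨Subgroup.topEquiv.symm⟩)⟩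
  · exact ⟨⊥, inferInstance, Or.inr inferInstance⟩

theorem GroupClass.Virtually.finite_or {G : Type u} [Group G]
    (hG : C.withTrivial.Virtually G) : Finite G ∨ C.Virtually G := by
  obtain ⟨K, hKf, hK | hK⟩ := hG
  · exact Or.inr ⟨K, hKf, hK⟩
  · refine Or.inl (Nat.finite_of_card_ne_zero ?_)
    rw [← K.card_mul_index]
    exact mul_ne_zero (by simp) hKf.index_ne_zero

/-- The extended volume is the volume of the normalized invariant. -/
theorem extVolume_eq_sigmaVolume (hCi : C.IsoClosed) (hCf : C.FiniteIndexClosed)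
    (hσ : σ.IsoInvariantOn C) {G : Type u} [Group G] (hG : C.withTrivial.Virtually G) :
    extVolume C σ G = sigmaVolume σ.normalized G := by
  by_cases hfin : Finite G
  · rw [extVolume, if_pos hfin]
    -- For finite `G` the net ends at the trivial subgroup, whose ratio is `-1 / |G|`.
    have hbot : ∀ K : Subgroup G, K ≤ ⊥ →
        σ.normalized K / (K.index : ℝ) = -1 / (Nat.card G : ℝ) := by
      intro K hK
      obtain rfl := le_bot_iff.1 hK
      rw [σ.normalized_of_subsingleton _ inferInstance, Subgroup.index_bot]
    exact le_antisymm
      (le_sigmaVolume fun H _ => ⟨⊥, inferInstance, bot_le, (hbot ⊥ le_rfl).ge⟩)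
      (sigmaVolume_le ⊥ inferInstance fun K _ hK => (hbot K hK).le)
  · have hv : C.Virtually G := hG.finite_or.resolve_left hfin
    rw [extVolume, if_neg hfin]
    split_ifs with h
    · exact sigmaVolume_normalized_of_infinite G hfin
    -- The definition of `extVolume` uses this same chosen subgroup; multiplicativity of the volume
    -- removes the dependence on it.
    · obtain ⟨hKf, hK⟩ := hv.choose_spec
      have hinf : ¬ Finite hv.choose := fun hK' => hfin (Nat.finite_of_card_ne_zero (by
        rw [← hv.choose.card_mul_index]
        exact mul_ne_zero Nat.card_pos.ne' hKf.index_ne_zero))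
      rw [sigmaVolume_normalized_of_infinite _ hinf]
      exact (sigmaVolume_eq_div hCi.withTrivial hCf.withTrivial hσ.normalized _ hKf
        (Or.inl hK)).symm

end Normalization

/-! ### Volumes of free products -/

section FreeProduct

variable {D : GroupClass.{u}} {τ : GroupInvariant.{u}} {A B : Type u} [Group A] [Group B]

instance Subgroup.finiteIndex_comap {K L : Type*} [Group K] [Group L] (φ : K →* L)
    (H : Subgroup L) [H.FiniteIndex] : (H.comap φ).FiniteIndex :=
  ⟨by rw [H.index_comap]; exact Subgroup.FiniteIndex.index_ne_zero⟩

theorem finiteIndex_of_conj {K L : Type*} [Group K] [Group L] (φ : K →* L) (H : Subgroup L)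
    [H.FiniteIndex] (g : L) {S : Subgroup K} (hS : ∀ k, k ∈ S ↔ g⁻¹ * φ k * g ∈ H) :
    S.FiniteIndex := by
  have : S = H.comap ((MulAut.conj g⁻¹).toMonoidHom.comp φ) := by
    ext k; simp [hS]
  rw [this]
  infer_instance

/-- Normality handles all conjugates at once, and intersecting with a subgroup in `D` puts the small
subgroups into `D` although `A` itself need not be there. -/
theorem GroupClass.Virtually.exists_normal (hDi : D.IsoClosed) (hDf : D.FiniteIndexClosed)
    (hA : D.Virtually A) (A₁ : Subgroup A) [A₁.FiniteIndex] :
    ∃ A₀ : Subgroup A, A₀.Normal ∧ A₀.FiniteIndex ∧ A₀ ≤ A₁ ∧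
      ∀ S : Subgroup A, S.FiniteIndex → S ≤ A₀ → D S := by
  obtain ⟨K, hKf, hK⟩ := hA
  refine ⟨(A₁ ⊓ K).normalCore, inferInstance, inferInstance,
    (Subgroup.normalCore_le _).trans inf_le_left, fun S hS hSK => ?_⟩
  exact GroupClass.mem_of_le hDi hDf hK hS
    (hSK.trans ((Subgroup.normalCore_le _).trans inf_le_right))

theorem le_of_conj_mem {K L : Type*} [Group K] [Group L] (φ : K →* L) (ψ : L →* K)
    (hψ : ∀ k, ψ (φ k) = k) {H : Subgroup L} {K₀ : Subgroup K} [K₀.Normal]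
    (hH : H ≤ K₀.comap ψ) {g : L} {S : Subgroup K} (hS : ∀ k, k ∈ S ↔ g⁻¹ * φ k * g ∈ H) :
    S ≤ K₀ := by
  intro k hk
  have h1 : ψ (g⁻¹ * φ k * g) ∈ K₀ := hH ((hS k).1 hk)
  rw [map_mul, map_mul, map_inv, hψ] at h1
  have := Subgroup.Normal.conj_mem ‹_› _ h1 (ψ g)
  rwa [show ψ g * ((ψ g)⁻¹ * k * ψ g) * (ψ g)⁻¹ = k by group] at this

/-- Only the membership half of `subgroup_le` is needed, so the zero invariant serves. -/
theorem GroupClass.Virtually.coprod (hDi : D.IsoClosed) (hDf : D.FiniteIndexClosed)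
    (h0 : IsFreelySubadditive D fun _ _ => 0) (hA : D.Virtually A) (hB : D.Virtually B) :
    D.Virtually (A ∗ B) := by
  obtain ⟨A₀, hAn, hAf, -, hAS⟩ := hA.exists_normal hDi hDf ⊤
  obtain ⟨B₀, hBn, hBf, -, hBS⟩ := hB.exists_normal hDi hDf ⊤
  obtain ⟨H, hH, hHA, hHB⟩ : ∃ H : Subgroup (A ∗ B), H.FiniteIndex ∧
      H ≤ A₀.comap fst ∧ H ≤ B₀.comap snd :=
    ⟨A₀.comap fst ⊓ B₀.comap snd, inferInstance, inf_le_left, inf_le_right⟩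
  refine ⟨H, hH, (h0.subgroup_le H (a := 0) (b := 0) (fun g S hS => ?_) fun g S hS => ?_).1⟩
  · exact ⟨hAS S (finiteIndex_of_conj inl H g hS)
      (le_of_conj_mem (inl : A →* A ∗ B) fst fst_apply_inl hHA hS), by simp⟩
  · exact ⟨hBS S (finiteIndex_of_conj inr H g hS)
      (le_of_conj_mem (inr : B →* A ∗ B) snd snd_apply_inr hHB hS), by simp⟩

/-- Upper bound for the volume of a free product. -/
theorem sigmaVolume_coprod_le (hDf : D.FiniteIndexClosed)
    (h : IsFreelySubadditive D fun G _ => τ G + 1) (hZ : τ InfCyclic = 0)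
    (hA : D.Virtually A) (hB : D.Virtually B) {v w : ℝ} (hv : sigmaVolume τ A = v)
    (hw : sigmaVolume τ B = w) : sigmaVolume τ (A ∗ B) ≤ ((v + w + 1 : ℝ) : EReal) := by
  refine EReal.le_of_forall_lt_iff_le.1 fun z hz => ?_
  have hz : v + w + 1 < z := EReal.coe_lt_coe_iff.1 hz
  -- Half of the gap for each factor.
  let δ := (z - (v + w + 1)) / 2
  have hδ : 0 < δ := by simp only [δ]; linarith
  obtain ⟨A₁, hA₁, hAr⟩ := exists_of_sigmaVolume_lt (τ := τ) (G := A) (r := v + δ)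
    (by rw [hv]; exact EReal.coe_lt_coe_iff.2 (by linarith))
  obtain ⟨B₁, hB₁, hBr⟩ := exists_of_sigmaVolume_lt (τ := τ) (G := B) (r := w + δ)
    (by rw [hw]; exact EReal.coe_lt_coe_iff.2 (by linarith))
  obtain ⟨A₀, hAn, hAf, hA₀, hAS⟩ := hA.exists_normal h.iso hDf A₁
  obtain ⟨B₀, hBn, hBf, hB₀, hBS⟩ := hB.exists_normal h.iso hDf B₁
  refine sigmaVolume_le (A₀.comap fst ⊓ B₀.comap snd) inferInstance fun H hH hHle => ?_
  have := (h.subgroup_le H (a := v + δ) (b := w + δ) (fun g S hS => ?_) fun g S hS => ?_).2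
  · have hpos := index_pos H hH
    rw [div_le_iff₀ hpos]
    have hzz : z = v + δ + (w + δ) + 1 := by simp only [δ]; ring
    -- Now the invariant of `InfCyclic` is `1`: its multiple by the index is the summand `1` of the
    -- bound, and the remaining `1` cancels that in `τ H + 1`.
    rw [hZ] at this
    rw [hzz]
    linarith
  · have hSf := finiteIndex_of_conj _ H g hS
    have hSle := le_of_conj_mem (inl : A →* A ∗ B) fst fst_apply_inl (hHle.trans inf_le_left) hS
    refine ⟨hAS S hSf hSle, ?_⟩
    have := hAr S hSf (hSle.trans hA₀)
    rw [div_le_iff₀ (index_pos S hSf)] at this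
    linarith
  · have hSf := finiteIndex_of_conj _ H g hS
    have hSle := le_of_conj_mem (inr : B →* A ∗ B) snd snd_apply_inr (hHle.trans inf_le_right) hS
    refine ⟨hBS S hSf hSle, ?_⟩
    have := hBr S hSf (hSle.trans hB₀)
    rw [div_le_iff₀ (index_pos S hSf)] at this
    linarith

/-- A conjugate subgroup has the same index and the same invariants. -/
theorem invariant_conj (hDi : D.IsoClosed) (hτ : τ.IsoInvariantOn D) {K : Type u} [Group K]
    {S T : Subgroup K} (t : K) (hST : ∀ k, k ∈ S ↔ t⁻¹ * k * t ∈ T) (hT : D T) :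
    D S ∧ τ S = τ T ∧ S.index = T.index := by
  have hS : S = T.map (MulAut.conj t).toMonoidHom := by
    ext k
    rw [hST]
    refine ⟨fun hk => ⟨_, hk, by simp [mul_assoc]⟩, ?_⟩
    rintro ⟨y, hy, rfl⟩
    simpa [mul_assoc] using hy
  have he : Nonempty (T ≃* S) := by
    rw [hS]
    exact ⟨T.equivMapOfInjective _ (MulAut.conj t).injective⟩
  have hDS := hDi T S hT he
  refine ⟨hDS, (hτ T S hT hDS he).symm, ?_⟩
  rw [hS]
  exact Subgroup.index_map_equiv T (MulAut.conj t)

/-- The element `g⁻¹ * φ k * g` is conjugate to `φ ((ψ g)⁻¹ * k * ψ g)`, so normality of `N` makes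
the condition on `N` follow from the one on `K'`. In the application `P` comes from the other
projection, which kills all conjugates of `φ k`. -/
theorem conj_mem_iff {K L : Type*} [Group K] [Group L] (φ : K →* L) (ψ : L →* K)
    (hψ : ∀ k, ψ (φ k) = k) {H N P : Subgroup L} [N.Normal] {K' : Subgroup K}
    (hH : H = N ⊓ (K'.comap ψ ⊓ P))
    (hK' : K' ≤ N.comap φ) (hP : ∀ g k, g⁻¹ * φ k * g ∈ P) (g : L) (k : K) :
    g⁻¹ * φ k * g ∈ H ↔ (ψ g)⁻¹ * k * ψ g ∈ K' := by
  have h1 : ψ (g⁻¹ * φ k * g) = (ψ g)⁻¹ * k * ψ g := by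
    rw [map_mul, map_mul, map_inv, hψ]
  rw [hH]
  refine ⟨fun h => h1 ▸ h.2.1, fun h => ⟨?_, ?_, hP g k⟩⟩
  · have h2 : φ ((ψ g)⁻¹ * k * ψ g) ∈ N := hK' h
    have h3 := Subgroup.Normal.conj_mem ‹_› _ h2 (g⁻¹ * φ (ψ g))
    have h4 : g⁻¹ * φ (ψ g) * φ ((ψ g)⁻¹ * k * ψ g) * (g⁻¹ * φ (ψ g))⁻¹ =
        g⁻¹ * φ k * g := by
      simp only [map_mul, map_inv]; group
    rwa [h4] at h3
  · change ψ _ ∈ K'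
    rwa [h1]

/-- Below every normal subgroup `N` of finite index there is a subgroup of finite index that meets
all conjugates of the factors in conjugates of prescribed small subgroups. -/
theorem exists_subgroup_conj_mem_iff (N : Subgroup (A ∗ B)) [N.Normal] [N.FiniteIndex]
    {A' : Subgroup A} {B' : Subgroup B} [A'.FiniteIndex] [B'.FiniteIndex]
    (hA' : A' ≤ N.comap inl) (hB' : B' ≤ N.comap inr) :
    ∃ H : Subgroup (A ∗ B), H.FiniteIndex ∧ H ≤ N ∧
      (∀ (g : A ∗ B) (k : A), g⁻¹ * inl k * g ∈ H ↔ (fst g)⁻¹ * k * fst g ∈ A') ∧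
      ∀ (g : A ∗ B) (k : B), g⁻¹ * inr k * g ∈ H ↔ (snd g)⁻¹ * k * snd g ∈ B' := by
  obtain ⟨H, hH⟩ : ∃ H, H = N ⊓ (A'.comap fst ⊓ B'.comap snd) := ⟨_, rfl⟩
  have hH' : H = N ⊓ (B'.comap snd ⊓ A'.comap fst) := by
    rw [hH, inf_comm (A'.comap (fst : A ∗ B →* A))]
  refine ⟨H, hH ▸ inferInstance, hH.le.trans inf_le_left,
    conj_mem_iff (inl : A →* A ∗ B) fst fst_apply_inl hH hA' (fun g k => by simp [Subgroup.mem_comap]),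
    conj_mem_iff (inr : B →* A ∗ B) snd snd_apply_inr hH' hB'
      (fun g k => by simp [Subgroup.mem_comap])⟩

/-- Lower bound for the volume of a free product. -/
theorem le_sigmaVolume_coprod (hDf : D.FiniteIndexClosed) (hτ : τ.IsoInvariantOn D)
    (h : IsFreelySubadditive D fun G _ => -(τ G + 1)) (hZ : τ InfCyclic = 0)
    (hA : D.Virtually A) (hB : D.Virtually B) {v w : ℝ} (hv : sigmaVolume τ A = v)
    (hw : sigmaVolume τ B = w) : ((v + w + 1 : ℝ) : EReal) ≤ sigmaVolume τ (A ∗ B) := by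
  refine EReal.ge_of_forall_gt_iff_ge.1 fun z hz => ?_
  have hz : z < v + w + 1 := EReal.coe_lt_coe_iff.1 hz
  let δ := (v + w + 1 - z) / 2
  have hδ : 0 < δ := by simp only [δ]; linarith
  refine le_sigmaVolume fun H₀ hH₀ => ?_
  let N := H₀.normalCore
  have hNf : N.FiniteIndex := inferInstance
  obtain ⟨A₀, hAn, hAf, hA₀, hAS⟩ := hA.exists_normal h.iso hDf (N.comap inl)
  obtain ⟨B₀, hBn, hBf, hB₀, hBS⟩ := hB.exists_normal h.iso hDf (N.comap inr)
  -- An upper limit yields only some small subgroups with a large ratio, not all of them. Hence the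
  -- stabilizers must be exactly conjugates of `A'` and `B'`, not merely contained in `A₀` and `B₀`.
  obtain ⟨A', hA'f, hA', hAr⟩ := exists_of_lt_sigmaVolume (τ := τ) (G := A) (r := v - δ)
    (by rw [hv]; exact EReal.coe_lt_coe_iff.2 (by linarith)) A₀ hAf
  obtain ⟨B', hB'f, hB', hBr⟩ := exists_of_lt_sigmaVolume (τ := τ) (G := B) (r := w - δ)
    (by rw [hw]; exact EReal.coe_lt_coe_iff.2 (by linarith)) B₀ hBf
  rw [lt_div_iff₀ (index_pos A' hA'f)] at hAr
  rw [lt_div_iff₀ (index_pos B' hB'f)] at hBr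
  obtain ⟨H, hH, hHN, hHA, hHB⟩ :=
    exists_subgroup_conj_mem_iff N (hA'.trans hA₀) (hB'.trans hB₀)
  refine ⟨H, hH, hHN.trans H₀.normalCore_le, ?_⟩
  have := (h.subgroup_le H (a := -(v - δ)) (b := -(w - δ)) (fun g S hS => ?_)
    fun g S hS => ?_).2
  · have hpos := index_pos H hH
    rw [le_div_iff₀ hpos]
    have hzz : z = v - δ + (w - δ) + 1 := by simp only [δ]; ring
    rw [hZ] at this
    rw [hzz]
    linarith
  · obtain ⟨h1, h2, h3⟩ := invariant_conj h.iso hτ (fst g) (fun k => (hS k).trans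
      (hHA g k))
      (hAS A' hA'f hA')
    refine ⟨h1, ?_⟩
    rw [h2, h3, hZ]
    linarith
  · obtain ⟨h1, h2, h3⟩ := invariant_conj h.iso hτ (snd g) (fun k => (hS k).trans
      (hHB g k))
      (hBS B' hB'f hB')
    refine ⟨h1, ?_⟩
    rw [h2, h3, hZ]
    linarith

end FreeProduct

/-! ### The main theorem -/

theorem lemma3p7 (C : GroupClass.{u}) (σ : GroupInvariant.{u})
    (hCiso : C.IsoClosed) (hCfree : C.FreeProductClosed) (hCfin : C.FiniteIndexClosed)
    (hCZ : C InfCyclic)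
    (hσiso : σ.IsoInvariantOn C) (hσbdd : σ.BoundedNetsOn C) (hσZ : σ InfCyclic = 0) :
    -- the extended volume is defined on free products of groups in `C` and finite groups
    (∀ (A B : Type u) [Group A] [Group B], C.OrFinite A → C.OrFinite B →
      Finite (A ∗ B) ∨ C.Virtually (A ∗ B)) ∧
    -- (i)
    ((∀ (A B : Type u) [Group A] [Group B], C A → C B → σ (A ∗ B) ≥ σ A + σ B + 1) →
      ∀ (A B : Type u) [Group A] [Group B], C.OrFinite A → C.OrFinite B →
        extVolume C σ (A ∗ B) ≥ extVolume C σ A + extVolume C σ B + 1) ∧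
    -- (ii)
    ((∀ (A B : Type u) [Group A] [Group B], C A → C B → σ (A ∗ B) ≤ σ A + σ B + 1) →
      ∀ (A B : Type u) [Group A] [Group B], C.OrFinite A → C.OrFinite B →
        extVolume C σ (A ∗ B) ≤ extVolume C σ A + extVolume C σ B + 1) := by

  have hi := hCiso.withTrivial
  have hf := hCfin.withTrivial
  have hτ := hσiso.normalized
  have hb := hσbdd.normalized
  have hZ : σ.normalized InfCyclic = 0 :=
    (σ.normalized_of_nontrivial _ not_subsingleton_infCyclic).trans hσZ
  have hvirt : ∀ (A B : Type u) [Group A] [Group B], C.OrFinite A → C.OrFinite B →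
      C.withTrivial.Virtually (A ∗ B) := fun A B _ _ hA hB =>
    -- The sign `0` makes subadditivity hold without either of the hypotheses in (i) and (ii).
    GroupClass.Virtually.coprod hi hf (by
      simpa using isFreelySubadditive_normalized hCiso hCfree hCZ hσiso 0 (by simp))
      (hA.virtually_withTrivial hCiso) (hB.virtually_withTrivial hCiso)
  refine ⟨fun A B _ _ hA hB => (hvirt A B hA hB).finite_or, fun h A B _ _ hA hB => ?_,
    fun h A B _ _ hA hB => ?_⟩
  all_goals
    have hA' := hA.virtually_withTrivial hCiso
    have hB' := hB.virtually_withTrivial hCiso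
    obtain ⟨v, hv⟩ := exists_sigmaVolume_eq_coe hi hf hτ hb hA'
    obtain ⟨w, hw⟩ := exists_sigmaVolume_eq_coe hi hf hτ hb hB'
    rw [extVolume_eq_sigmaVolume hCiso hCfin hσiso hA',
      extVolume_eq_sigmaVolume hCiso hCfin hσiso hB',
      extVolume_eq_sigmaVolume hCiso hCfin hσiso (hvirt A B hA hB), hv, hw]
  · refine le_sigmaVolume_coprod hf hτ ?_ hZ hA' hB' hv hw
    -- The sign `-1` turns the superadditivity in (i) into subadditivity.
    simpa using isFreelySubadditive_normalized hCiso hCfree hCZ hσiso (-1)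
      fun A B _ _ hA hB => by linarith [h A B hA hB]
  · refine sigmaVolume_coprod_le hf ?_ hZ hA' hB' hv hw
    simpa using isFreelySubadditive_normalized hCiso hCfree hCZ hσiso 1
      fun A B _ _ hA hB => by linarith [h A B hA hB]
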